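/- **Theorem (Center of mass).** Let $k\ge 1$. Work in $k$-dimensional plane-based geometric algebra (PGA) $\mathbb{R}_{k,0,1}$, the real Clifford algebra with orthogonal generators $e_0,e_1,\dots,e_k$, $e_0^2=0$, $e_1^2=\dots=e_k^2=1$. Here $\wedge$ is the exterior product; $*$ is the Hodge dual, the linear map sending each basis blade $e_J$ to the multiple $e_J^*=\pm e_{J^c}$ of the complementary blade with $e_J\,e_J^*=e_{01\cdots k}$; and the join $\vee$ is defined by $(A\vee B)^*=A^*\wedge B^*$. A position $x\in\mathbb{R}^k$ is represented by the normalized point $(e_0+x_1e_1+\dots+x_ke_k)^*$; we use the same letter for a position and its normalized point. The join of $k+1$ points is a scalar. Let $\mathcal K$ be a finite geometric simplicial complex in $\mathbb{R}^k$ with at least one $k$-simplex, let $C\subset\mathbb{R}^k$ be the region it occupies and $\lVert C\rVert$ the volume ($k$-dimensional Lebesgue measure) of $C$. Assume the $k$-simplices of $\mathcal K$ are consistently oriented: each is given as an ordered simplex $[v_0,\dots,v_k]$, and all the scalars $v_0\vee\dots\vee v_k$ have the same sign $s\in\{1,-1\}$. Let $\partial\mathcal K$ be the oriented boundary: the $(k-1)$-simplices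 that lie in exactly one $k$-simplex, each written once as $\pm[v_0,\dots,v_{k-1}]$ in some vertex order, with the sign induced by $\partial[v_0,\dots,v_k]=\sum_{i=0}^k(-1)^i[v_0,\dots,v_{i-1},v_{i+1},\dots,v_k]$ and antisymmetry under permutations of the vertices (the sign multiplies the corresponding summand below). Put $\varepsilon=(-1)^k s$; thus $\varepsilon=1$ exactly when $\partial\mathcal K$ is oriented so that $v_0\vee\dots\vee v_{k-1}\vee w>0$ for every boundary facet $[v_0,\dots,v_{k-1}]$ (with its sign) and the remaining vertex $w$ of the $k$-simplex containing it. Then $\lVert C\rVert>0$, the position $x$ is integrable over $C$, the center of mass of $C$ for any constant mass density $\rho>0$ is the point at position $\frac1{\lVert C\rVert}\int_C x\,dV$, and as a normalized point $C_{\mathrm{com}}$ it satisfies, for every point $o$ of $\mathbb{R}^k$, $$C_{\mathrm{com}}=\frac{\varepsilon}{\lVert C\rVert\,(k+1)!}\sum_{\partial\mathcal K}(v_0+\dots+v_{k-1}+o)\,(v_0\vee\dots\vee v_{k-1}\vee o).$$ In particular, for the orientation with $\varepsilon=1$, $$C_{\mathrm{com}}=\frac{1}{\lVert C\rVert\,(k+1)!}\sum_{\partial\mathcal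 K}(v_0+\dots+v_{k-1}+o)\,(v_0\vee\dots\vee v_{k-1}\vee o).$$ Without the normalizing factor one gets the homogeneous point weighted by the (signed) volume: $$\frac{1}{(k+1)!}\sum_{\partial\mathcal K}(v_0+\dots+v_{k-1}+o)\,(v_0\vee\dots\vee v_{k-1}\vee o)=\varepsilon\,\lVert C\rVert\,C_{\mathrm{com}}.$$ -/

import Mathlib

open MeasureTheory

noncomputable section

namespace PGA

/-! ## Plane-based geometric algebra `ℝ_{k,0,1}` -/

/-- The Euclidean space whose points and simplices are represented. -/
abbrev Space (k : ℕ) : Type := EuclideanSpace ℝ (Fin k)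

/-- The quadratic form of signature `(k, 0, 1)`: `e₀² = 0` and `e₁² = ⋯ = e_k² = 1`. -/
def metric (k : ℕ) : QuadraticForm ℝ (Fin (k + 1) → ℝ) :=
  QuadraticMap.weightedSumSquares ℝ (Fin.cons 0 (fun _ => 1) : Fin (k + 1) → ℝ)

/-- The multivectors of `k`-dimensional PGA, with `*` as geometric product. -/
abbrev Multivector (k : ℕ) : Type := CliffordAlgebra (metric k)

/-- The generator `e_i`, `0 ≤ i ≤ k`. -/
def e {k : ℕ} (i : Fin (k + 1)) : Multivector k :=
  CliffordAlgebra.ι (metric k) (Pi.single i 1)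

/-- The wedge product (meet): the product of the Grassmann algebra, transported along the canonical
linear isomorphism between the Clifford and the exterior algebra. -/
def wedge {k : ℕ} (A B : Multivector k) : Multivector k :=
  (CliffordAlgebra.equivExterior (metric k)).symm
    (CliffordAlgebra.equivExterior (metric k) A * CliffordAlgebra.equivExterior (metric k) B)

/-- The basis blades `e_J = e_{j₁} ∧ ⋯ ∧ e_{jₘ}`, `J = {j₁ < ⋯ < jₘ}`. -/
def blade (k : ℕ) : Module.Basis (Finset (Fin (k + 1))) ℝ (Multivector k) :=
  (Pi.basisFun ℝ (Fin (k + 1))).ExteriorAlgebra.map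
    (CliffordAlgebra.equivExterior (metric k)).symm

/-- The pseudoscalar `e_{01⋯k}`. -/
def pseudoscalar (k : ℕ) : Multivector k := blade k Finset.univ

/-- The sign for which `e_J e_{Jᶜ} = ± e_{01⋯k}`: the parity of the number of pairs
`(i, j) ∈ J × Jᶜ` with `j < i`. -/
def complementSign {k : ℕ} (J : Finset (Fin (k + 1))) : ℝ :=
  (-1) ^ ((J ×ˢ Jᶜ).filter fun p => p.2 < p.1).card

/-- The Hodge dual (right complement): the linear map with `e_J* = ± e_{Jᶜ}` and
`e_J e_J* = e_{01⋯k}`. -/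
def dual {k : ℕ} : Multivector k →ₗ[ℝ] Multivector k :=
  (blade k).constr ℝ fun J => complementSign J • blade k Jᶜ

/-- The undual (left complement), inverse to `dual`. -/
def undual {k : ℕ} : Multivector k →ₗ[ℝ] Multivector k :=
  (blade k).constr ℝ fun J => complementSign Jᶜ • blade k Jᶜ

/-- The join (regressive product), `(A ∨ B)* = A* ∧ B*`. -/
def join {k : ℕ} (A B : Multivector k) : Multivector k :=
  undual (wedge (dual A) (dual B))

/-- The normalized PGA point at position `x`, `(e₀ + x₁ e₁ + ⋯ + x_k e_k)*`. -/
def point {k : ℕ} (x : Space k) : Multivector k :=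
  dual (CliffordAlgebra.ι (metric k) (Fin.cons 1 fun i => x i))

/-- The carrier `v₀ ∨ ⋯ ∨ v_{m-1}` of an ordered family of points. The fold starts at the
pseudoscalar, which is the neutral element of the join. -/
def carrier {k m : ℕ} (v : Fin m → Space k) : Multivector k :=
  (List.ofFn fun i => point (v i)).foldl join (pseudoscalar k)

/-! ### The dual and the join satisfy their defining equations -/

theorem complementSign_mul_self {k : ℕ} (J : Finset (Fin (k + 1))) :
    complementSign J * complementSign J = 1 := by
  unfold complementSign
  rw [← mul_pow]; simp

theorem dual_blade {k : ℕ} (J : Finset (Fin (k + 1))) :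
    dual (blade k J) = complementSign J • blade k Jᶜ := by
  simp [dual]

theorem undual_blade {k : ℕ} (J : Finset (Fin (k + 1))) :
    undual (blade k J) = complementSign Jᶜ • blade k Jᶜ := by
  simp [undual]

theorem undual_dual {k : ℕ} (A : Multivector k) : undual (dual A) = A := by
  have h : undual ∘ₗ dual = (LinearMap.id : Multivector k →ₗ[ℝ] Multivector k) := by
    refine (blade k).ext fun J => ?_
    simp [dual_blade, undual_blade, smul_smul, complementSign_mul_self]
  exact LinearMap.congr_fun h A

theorem dual_undual {k : ℕ} (A : Multivector k) : dual (undual A) = A := by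
  have h : dual ∘ₗ undual = (LinearMap.id : Multivector k →ₗ[ℝ] Multivector k) := by
    refine (blade k).ext fun J => ?_
    simp [dual_blade, undual_blade, smul_smul, complementSign_mul_self]
  exact LinearMap.congr_fun h A

theorem dual_join {k : ℕ} (A B : Multivector k) :
    dual (join A B) = wedge (dual A) (dual B) := dual_undual _

theorem exterior_blade {k : ℕ} (J : Finset (Fin (k + 1))) :
    (Pi.basisFun ℝ (Fin (k + 1))).ExteriorAlgebra J =
      ((J.sort (· ≤ ·)).map fun i =>
        ExteriorAlgebra.ι ℝ (Pi.single i 1 : Fin (k + 1) → ℝ)).prod := by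
  rw [ExteriorAlgebra.basis_apply]
  change ExteriorAlgebra.ιMulti ℝ _ _ = _
  rw [ExteriorAlgebra.ιMulti_apply]
  congr 1
  refine List.ext_getElem (by simp) fun n h₁ h₂ => ?_
  simp [Set.powersetCard.ofFinEmbEquiv, Finset.orderEmbOfFin_apply]

theorem polar_single {k : ℕ} {i j : Fin (k + 1)} (h : i ≠ j) :
    QuadraticMap.polar (metric k) (Pi.single i 1) (Pi.single j 1) = 0 := by
  simp only [QuadraticMap.polar, metric, QuadraticMap.weightedSumSquares_apply,
    ← Finset.sum_sub_distrib]
  refine Finset.sum_eq_zero fun l _ => ?_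
  by_cases hi : l = i <;> by_cases hj : l = j <;> simp_all

theorem e_mul_e {k : ℕ} {i j : Fin (k + 1)} (h : i ≠ j) :
    (e i * e j : Multivector k) = -(e j * e i) := by
  have := CliffordAlgebra.ι_mul_ι_add_swap (Q := metric k) (Pi.single i 1) (Pi.single j 1)
  rw [polar_single h, map_zero] at this
  exact eq_neg_of_add_eq_zero_left this

theorem contract_prod {k : ℕ} (d : Module.Dual ℝ (Fin (k + 1) → ℝ)) (l : List (Fin (k + 1)))
    (h : ∀ j ∈ l, d (Pi.single j 1) = 0) :
    CliffordAlgebra.contractLeft d ((l.map e).prod : Multivector k) = 0 := by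
  induction l with
  | nil => simp
  | cons a l ih =>
    rw [List.map_cons, List.prod_cons, e, CliffordAlgebra.contractLeft_ι_mul, h a (by simp),
      ih fun j hj => h j (by simp [hj])]
    simp

theorem equivExterior_prod {k : ℕ} (l : List (Fin (k + 1))) (hl : l.Nodup) :
    CliffordAlgebra.equivExterior (metric k) ((l.map e).prod) =
      (l.map fun i => ExteriorAlgebra.ι ℝ (Pi.single i 1 : Fin (k + 1) → ℝ)).prod := by
  induction l with
  | nil => simp
  | cons a l ih =>
    rw [List.nodup_cons] at hl
    rw [List.map_cons, List.prod_cons, List.map_cons, List.prod_cons, ← ih hl.2]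
    simp only [CliffordAlgebra.equivExterior, CliffordAlgebra.changeFormEquiv_apply]
    rw [e, CliffordAlgebra.changeForm_ι_mul, ← CliffordAlgebra.changeForm_contractLeft,
      contract_prod]
    · simp
    · intro j hj
      have : a ≠ j := fun h => hl.1 (h ▸ hj)
      simpa [QuadraticMap.associated_apply, QuadraticMap.polar] using polar_single this

theorem blade_eq_prod {k : ℕ} (J : Finset (Fin (k + 1))) :
    blade k J = ((J.sort (· ≤ ·)).map e).prod := by
  rw [blade, Module.Basis.map_apply, LinearEquiv.symm_apply_eq,
    equivExterior_prod _ (Finset.sort_nodup _ _), exterior_blade]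

theorem e_mul_blade {k : ℕ} (i : Fin (k + 1)) (S : Finset (Fin (k + 1))) (h : i ∉ S) :
    e i * blade k S = (-1 : ℝ) ^ (S.filter (· < i)).card • blade k (insert i S) := by
  induction S using Finset.induction_on_min with
  | empty => simp [blade_eq_prod]
  | insert a S ha ih =>
    have haS : a ∉ S := fun h => lt_irrefl _ (ha a h)
    simp only [Finset.mem_insert, not_or] at h
    rcases lt_or_gt_of_ne h.1 with hia | hai
    · rw [Finset.filter_false_of_mem]
      · rw [blade_eq_prod (insert i _), Finset.sort_insert (· ≤ ·)]
        · simp [blade_eq_prod]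
        · simp only [Finset.mem_insert]; rintro b (rfl | hb)
          · exact hia.le
          · exact (hia.trans (ha b hb)).le
        · simp [h]
      · simp only [Finset.mem_insert]; rintro b (rfl | hb)
        · exact hia.le.not_gt
        · exact (hia.trans (ha b hb)).le.not_gt
    · have h1 : blade k (insert a S) = e a * blade k S := by
        rw [blade_eq_prod, Finset.sort_insert (· ≤ ·) (fun b hb => (ha b hb).le) haS]
        simp [blade_eq_prod]
      have h2 : blade k (insert i (insert a S)) = e a * blade k (insert i S) := by
        rw [Finset.insert_comm, blade_eq_prod, Finset.sort_insert (· ≤ ·)]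
        · simp [blade_eq_prod]
        · simp only [Finset.mem_insert]; rintro b (rfl | hb)
          · exact hai.le
          · exact (ha b hb).le
        · simp [haS, Ne.symm h.1]
      rw [h1, h2, ← mul_assoc, e_mul_e h.1, neg_mul, mul_assoc, ih h.2, Finset.filter_insert,
        if_pos hai, Finset.card_insert_of_notMem (by simp [haS]), pow_succ]
      simp

theorem blade_mul_blade {k : ℕ} (S T : Finset (Fin (k + 1))) (h : Disjoint S T) :
    blade k S * blade k T =
      (-1 : ℝ) ^ ((S ×ˢ T).filter fun p => p.2 < p.1).card • blade k (S ∪ T) := by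
  induction S using Finset.induction_on_min with
  | empty => simp [blade_eq_prod]
  | insert a S ha ih =>
    have haS : a ∉ S := fun h => lt_irrefl _ (ha a h)
    rw [Finset.disjoint_insert_left] at h
    have h1 : blade k (insert a S) = e a * blade k S := by
      rw [blade_eq_prod, Finset.sort_insert (· ≤ ·) (fun b hb => (ha b hb).le) haS]
      simp [blade_eq_prod]
    have h2 : ((S ∪ T).filter (· < a)) = T.filter (· < a) := by
      ext b; simp only [Finset.mem_filter, Finset.mem_union]
      constructor
      · rintro ⟨hb | hb, hba⟩
        · exact absurd hba (ha b hb).le.not_gt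
        · exact ⟨hb, hba⟩
      · rintro ⟨hb, hba⟩; exact ⟨Or.inr hb, hba⟩
    have h3 : ((insert a S ×ˢ T).filter fun p => p.2 < p.1).card =
        ((S ×ˢ T).filter fun p => p.2 < p.1).card + (T.filter (· < a)).card := by
      rw [show insert a S ×ˢ T = ({a} ×ˢ T) ∪ (S ×ˢ T) by rw [Finset.insert_eq, Finset.union_product], Finset.singleton_product, Finset.filter_union, Finset.card_union_of_disjoint, add_comm]
      · congr 1
        rw [Finset.filter_map, Finset.card_map]
        rfl
      · rw [Finset.disjoint_left]
        simp only [Finset.mem_filter, Finset.mem_map, Finset.mem_product]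
        rintro _ ⟨⟨b, _, rfl⟩, _⟩ ⟨⟨h, _⟩, _⟩
        exact haS h
    rw [h1, mul_assoc, ih h.2, mul_smul_comm, e_mul_blade _ _ (by simp [haS, h.1]), h2, smul_smul,
      h3, pow_add, Finset.insert_union]

/-- The dual is the right complement with respect to the geometric product. -/
theorem blade_mul_dual {k : ℕ} (J : Finset (Fin (k + 1))) :
    blade k J * dual (blade k J) = pseudoscalar k := by
  rw [dual_blade, mul_smul_comm, blade_mul_blade _ _ disjoint_compl_right, smul_smul]
  change (complementSign J * complementSign J) • _ = _
  rw [complementSign_mul_self, one_smul, Finset.union_compl, pseudoscalar]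

/-! ## Oriented simplicial complexes, their boundary, and the center of mass -/

open Classical in
/-- The vertex set of an ordered simplex. -/
def vertexSet {k m : ℕ} (v : Fin m → Space k) : Finset (Space k) := Finset.univ.image v

/-- A finite simplicial complex in `k`-dimensional Euclidean space, each of whose `k`-simplices is
given as an ordered simplex `[v₀, …, v_k]` (exactly one ordering per `k`-simplex). -/
structure OrientedComplex (k : ℕ) where
  /-- the underlying geometric simplicial complex -/
  complex : Geometry.SimplicialComplex ℝ (Space k)
  finite_faces : complex.faces.Finite
  /-- the ordered `k`-simplices -/
  simplices : Finset (Fin (k + 1) → Space k)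
  bijOn_simplices :
    Set.BijOn vertexSet (simplices : Set (Fin (k + 1) → Space k)) {F | F ∈ complex.faces ∧ F.card = k + 1}

namespace OrientedComplex

variable {k : ℕ} (K : OrientedComplex k)

/-- The region occupied by the complex. -/
def body : Set (Space k) := K.complex.space

/-- All ordered `k`-simplices have a carrier `v₀ ∨ ⋯ ∨ v_k` of the same sign `s = ±1`
(this carrier is a scalar in `k`-dimensional PGA). -/
def IsConsistentlyOriented (s : ℤˣ) : Prop :=
  ∀ v ∈ K.simplices, ∃ r : ℝ, 0 < r ∧
    carrier v = algebraMap ℝ (Multivector k) (((s : ℤ) : ℝ) * r)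

/-- The `(k-1)`-simplices on the boundary: those that belong to exactly one `k`-simplex. -/
def boundaryFacets : Set (Finset (Space k)) :=
  {F | F ∈ K.complex.faces ∧ F.card = k ∧
    ∃! G : Finset (Space k), G ∈ K.complex.faces ∧ G.card = k + 1 ∧ F ⊆ G}

/-- The chain `B = ∑ c_u [u₀, …, u_{k-1}]` is the oriented boundary `∂K`: it contains every boundary
facet exactly once, in some vertex order, with the sign `c_u = ±1` that the facet has in
`∂[v₀, …, v_k] = ∑ i, (-1)^i [v₀, …, v_{i-1}, v_{i+1}, …, v_k]`, where `[v₀, …, v_k]` is the ordered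
`k`-simplex containing it and `[u ∘ π] = sign π [u]`. -/
structure IsOrientedBoundary (B : (Fin k → Space k) →₀ ℤ) : Prop where
  bijOn_support : Set.BijOn vertexSet (B.support : Set (Fin k → Space k)) K.boundaryFacets
  induced : ∀ u ∈ B.support, ∃ v ∈ K.simplices, ∃ (i : Fin (k + 1)) (π : Equiv.Perm (Fin k)),
    u = v ∘ i.succAbove ∘ π ∧ B u = (-1) ^ (i : ℕ) * (Equiv.Perm.sign π : ℤ)

end OrientedComplex

/-- The center of mass of a body `C` with mass density `ρ`. -/
def centerOfMass {k : ℕ} (C : Set (Space k)) (ρ : Space k → ℝ) : Space k :=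
  (∫ x in C, ρ x)⁻¹ • ∫ x in C, ρ x • x

end PGA

end

/-!
In homogeneous coordinates `hom x = (1, x₁, …, x_k)` the join of `k + 1` points is the scalar
`homDet v = det (hom v₀, …, hom v_k)`, that is, `k!` times the signed volume of the simplex
(`carrier_eq_algebraMap`). The dual turns joins into exterior products; dualizing a vector twice
gives the sign `(-1)^k`, and these signs cancel for `k + 1` points since `k (k + 1)` is even.

For one simplex `[v₀, …, v_k]` write `o = ∑ λᵢ vᵢ` in barycentric coordinates. By Cramer's rule the
facet opposite to `vᵢ`, joined with `o`, has the signed value `(-1)^k λᵢ D`, where `D = homDet v`.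
So its boundary sum is `(-1)^k D ∑ λᵢ (∑ⱼ vⱼ - vᵢ + o) = (-1)^k D ∑ⱼ vⱼ`, whatever `o` is
(`sum_facetTerm_succAbove`).

Summing over all `k`-simplices leaves only the boundary of the complex: two `k`-simplices with a
common facet lie on opposite sides of it, because otherwise their interiors would meet, and so they
induce opposite orientations on the facet (`smul_facetTerm_eq_neg`,
`sum_boundary_eq_sum_simplices`).

On the other side, a simplex has volume `|D| / k!`, and its first moment is its volume times the
mean of its vertices (`volume_real_convexHull`, `setIntegral_convexHull_id`). The `k`-simplices
cover the body up to a null set and overlap in null sets (`setIntegral_body`), hence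
`‖C‖ C_com = ∑ (|D| / (k + 1)!) ∑ⱼ vⱼ`. As `D = s |D|`, the two sums agree up to `ε = (-1)^k s`.
-/

noncomputable section

namespace PGA

variable {k m : ℕ}

/-! ### Joins of points as determinants -/

/-- The homogeneous coordinates `(1, x₁, …, x_k)` of the position `x`. -/
def hom (x : Space k) : Fin (k + 1) → ℝ := Fin.cons 1 fun i => x i

/-- The determinant of the homogeneous coordinates of `k + 1` points: `k!` times the signed volume
of the simplex they span. -/
def homDet (v : Fin (k + 1) → Space k) : ℝ :=
  Matrix.detRowAlternating fun i => hom (v i)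

/-- The dual of a multivector, read as an element of the exterior algebra. It turns joins into
products. -/
def extDual : Multivector k →ₗ[ℝ] ExteriorAlgebra ℝ (Fin (k + 1) → ℝ) :=
  (CliffordAlgebra.equivExterior (metric k)).toLinearMap ∘ₗ dual

theorem extDual_injective : Function.Injective (extDual (k := k)) := by
  intro A B h
  have h' : dual A = dual B := (CliffordAlgebra.equivExterior (metric k)).injective h
  rw [← undual_dual A, h', undual_dual]

theorem extDual_join (A B : Multivector k) :
    extDual (join A B) = extDual A * extDual B := by
  simp only [extDual, LinearMap.comp_apply, dual_join, wedge, LinearEquiv.coe_coe,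
    LinearEquiv.apply_symm_apply]

/-- Every pair in `J × Jᶜ` is an inversion for exactly one of `J` and `Jᶜ`. -/
theorem complementSign_mul_compl (J : Finset (Fin (k + 1))) :
    complementSign J * complementSign Jᶜ = (-1) ^ (J.card * Jᶜ.card) := by
  unfold complementSign
  rw [← pow_add, compl_compl, ← Finset.card_product]
  congr 1
  rw [← Finset.card_filter_add_card_filter_not (s := J ×ˢ Jᶜ) fun p => p.2 < p.1]
  congr 1
  refine Finset.card_bij (fun p _ => p.swap) ?_ (fun _ _ _ _ h => Prod.swap_injective h) ?_
  · rintro ⟨a, b⟩ h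
    simp only [Finset.mem_filter, Finset.mem_product, Prod.swap] at h ⊢
    exact ⟨h.1.symm, h.2.le.not_gt⟩
  · rintro ⟨a, b⟩ h
    simp only [Finset.mem_filter, Finset.mem_product, Finset.mem_compl] at h
    refine ⟨(b, a), ?_, rfl⟩
    simp only [Finset.mem_filter, Finset.mem_product, Finset.mem_compl]
    refine ⟨h.1.symm, lt_of_le_of_ne (not_lt.mp h.2) ?_⟩
    rintro rfl
    exact h.1.2 h.1.1

theorem blade_singleton (i : Fin (k + 1)) : blade k {i} = e i := by
  simp [blade_eq_prod]

theorem ι_eq_sum_e (x : Fin (k + 1) → ℝ) :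
    CliffordAlgebra.ι (metric k) x = ∑ i, x i • (e i : Multivector k) := by
  conv_lhs => rw [pi_eq_sum_univ' x]
  simp only [map_sum, map_smul]
  rfl

/-- The double dual is `(-1)^k` on vectors. -/
theorem dual_dual_ι (x : Fin (k + 1) → ℝ) :
    dual (dual (CliffordAlgebra.ι (metric k) x)) =
      (-1 : ℝ) ^ k • CliffordAlgebra.ι (metric k) x := by
  simp only [ι_eq_sum_e, map_sum, map_smul, Finset.smul_sum, ← blade_singleton, dual_blade,
    compl_compl, smul_smul]
  refine Finset.sum_congr rfl fun i _ => ?_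
  rw [mul_assoc, complementSign_mul_compl]
  simp [Finset.card_compl, mul_comm]

theorem extDual_point (x : Space k) :
    extDual (point x) = (-1 : ℝ) ^ k • ExteriorAlgebra.ι ℝ (hom x) := by
  simp only [extDual, point, LinearMap.comp_apply, dual_dual_ι, map_smul]
  congr 1
  simp [CliffordAlgebra.equivExterior, hom]

theorem extDual_pseudoscalar : extDual (pseudoscalar k) = 1 := by
  rw [extDual, LinearMap.comp_apply, pseudoscalar, dual_blade, Finset.compl_univ, blade_eq_prod]
  simp [complementSign]

theorem extDual_foldl (l : List (Multivector k)) (A : Multivector k) :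
    extDual (l.foldl join A) = extDual A * (l.map extDual).prod := by
  induction l generalizing A with
  | nil => simp
  | cons a l ih => simp [ih, extDual_join, mul_assoc]

theorem extDual_carrier (v : Fin m → Space k) :
    extDual (carrier v) =
      (-1 : ℝ) ^ (k * m) • ExteriorAlgebra.ιMulti ℝ m fun i => hom (v i) := by
  rw [carrier, extDual_foldl, extDual_pseudoscalar, one_mul, List.map_ofFn]
  have : (extDual ∘ fun i => point (v i)) =
      fun i => ExteriorAlgebra.ι ℝ ((-1 : ℝ) ^ k • hom (v i)) := by
    ext i; simp [extDual_point]
  rw [this, ← ExteriorAlgebra.ιMulti_apply,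
    AlternatingMap.map_smul_univ (ExteriorAlgebra.ιMulti ℝ m) (fun _ => (-1 : ℝ) ^ k)]
  simp [pow_mul]

theorem join_carrier_point (u : Fin m → Space k) (o : Space k) :
    join (carrier u) (point o) = carrier (Fin.snoc u o) := by
  rw [carrier, carrier, List.ofFn_succ_last, List.foldl_append]
  simp

theorem ιMulti_eq_det_smul (w : Fin (k + 1) → Fin (k + 1) → ℝ) :
    ExteriorAlgebra.ιMulti ℝ (k + 1) w =
      Matrix.detRowAlternating w •
        ExteriorAlgebra.ιMulti ℝ (k + 1) (fun i => (Pi.single i 1 : Fin (k + 1) → ℝ)) := by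
  have : ExteriorAlgebra.ιMulti ℝ (k + 1) =
      (LinearMap.toSpanSingleton ℝ _ (ExteriorAlgebra.ιMulti ℝ (k + 1)
        (fun i => (Pi.single i 1 : Fin (k + 1) → ℝ)))).compAlternatingMap
          Matrix.detRowAlternating := by
    refine (Pi.basisFun ℝ (Fin (k + 1))).ext_alternating fun f hf => ?_
    obtain ⟨σ, rfl⟩ : ∃ σ : Equiv.Perm (Fin (k + 1)), f = σ :=
      ⟨Equiv.ofBijective f (Finite.injective_iff_bijective.mp hf), rfl⟩
    have h1 := AlternatingMap.map_perm (ExteriorAlgebra.ιMulti ℝ (k + 1))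
      (fun i => (Pi.single i 1 : Fin (k + 1) → ℝ)) σ
    have h2 := AlternatingMap.map_perm (Matrix.detRowAlternating (R := ℝ))
      (fun i => (Pi.single i 1 : Fin (k + 1) → ℝ)) σ
    have h3 : Matrix.detRowAlternating (R := ℝ)
        (fun i => (Pi.single i 1 : Fin (k + 1) → ℝ)) = 1 := by
      refine (congrArg Matrix.det ?_).trans (Matrix.det_one (n := Fin (k + 1)) (R := ℝ))
      ext i j
      simp [Matrix.one_apply, Pi.single_apply, eq_comm]
    simp only [Function.comp_def] at h1 h2
    simp only [Pi.basisFun_apply, LinearMap.compAlternatingMap_apply,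
      LinearMap.toSpanSingleton_apply, h1, h2, h3]
    rw [smul_assoc, one_smul]
  conv_lhs => rw [this]
  simp

theorem extDual_one : extDual (1 : Multivector k) =
    ExteriorAlgebra.ιMulti ℝ (k + 1) (fun i => (Pi.single i 1 : Fin (k + 1) → ℝ)) := by
  have h1 : (1 : Multivector k) = blade k ∅ := by simp [blade_eq_prod]
  rw [h1, extDual, LinearMap.comp_apply, dual_blade, map_smul, blade, Module.Basis.map_apply,
    LinearEquiv.coe_coe, LinearEquiv.apply_symm_apply, exterior_blade, Finset.compl_empty,
    Fin.sort_univ, ExteriorAlgebra.ιMulti_apply, List.ofFn_eq_map]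
  simp only [complementSign, Finset.empty_product, Finset.filter_empty, Finset.card_empty, pow_zero,
    one_smul]

/-- The join of `k + 1` points is the scalar `homDet`. -/
theorem carrier_eq_algebraMap (v : Fin (k + 1) → Space k) :
    carrier v = algebraMap ℝ (Multivector k) (homDet v) := by
  apply extDual_injective
  rw [extDual_carrier, Algebra.algebraMap_eq_smul_one, map_smul, extDual_one, ιMulti_eq_det_smul,
    (Nat.even_mul_succ_self k).neg_one_pow, one_smul, homDet]

/-- The linear extension of `point` to homogeneous coordinates. -/
def homPoint : (Fin (k + 1) → ℝ) →ₗ[ℝ] Multivector k := dual ∘ₗ CliffordAlgebra.ι (metric k)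

theorem point_eq_homPoint (x : Space k) : point x = homPoint (hom x) := rfl

theorem algebraMap_multivector_injective :
    Function.Injective (algebraMap ℝ (Multivector k)) := by
  have : Nontrivial (Multivector k) :=
    (CliffordAlgebra.equivExterior (metric k)).symm.injective.nontrivial
  exact FaithfulSMul.algebraMap_injective ℝ (Multivector k)

/-! ### The boundary sum of a single simplex -/

theorem hom_comp_insertNth (p : Fin (m + 1)) (x : Space k) (u : Fin m → Space k) :
    (fun i => hom ((p.insertNth x u : Fin (m + 1) → Space k) i)) =
      p.insertNth (hom x) fun i => hom (u i) := by
  funext i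
  refine Fin.succAboveCases p ?_ (fun j => ?_) i <;> simp

theorem homDet_cons (x : Space k) (u : Fin k → Space k) :
    homDet (Fin.cons x u) =
      (Matrix.detRowAlternating (R := ℝ) (n := Fin (k + 1))).curryLeft (hom x)
        fun i => hom (u i) := by
  have h : (fun i => hom ((Fin.cons x u : Fin (k + 1) → Space k) i)) =
      Matrix.vecCons (hom x) fun i => hom (u i) := by
    funext i
    refine Fin.cases ?_ (fun j => ?_) i <;> simp
  rw [homDet, h]
  rfl

theorem homDet_insertNth (p : Fin (k + 1)) (x : Space k) (u : Fin k → Space k) :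
    homDet (p.insertNth x u) = (-1) ^ (p : ℕ) * homDet (Fin.cons x u) := by
  rw [homDet, hom_comp_insertNth, AlternatingMap.map_insertNth, homDet_cons, zsmul_eq_mul]
  push_cast
  rfl

theorem homDet_snoc (x : Space k) (u : Fin k → Space k) :
    homDet (Fin.snoc u x) = (-1) ^ k * homDet (Fin.cons x u) := by
  rw [← Fin.insertNth_last', homDet_insertNth, Fin.val_last]

/-- Replacing the `i`-th point, compared with deleting it and appending the new one at the end. -/
theorem homDet_snoc_succAbove (v : Fin (k + 1) → Space k) (i : Fin (k + 1)) (x : Space k) :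
    (-1) ^ (i : ℕ) * homDet (Fin.snoc (v ∘ i.succAbove) x) =
      (-1) ^ k * homDet (Function.update v i x) := by
  rw [← Fin.insertNth_removeNth, homDet_insertNth, homDet_snoc, mul_left_comm]
  rfl

theorem homDet_comp_perm (v : Fin (k + 1) → Space k) (π : Equiv.Perm (Fin (k + 1))) :
    homDet (v ∘ π) = (Equiv.Perm.sign π : ℤ) * homDet v := by
  have := AlternatingMap.map_perm (Matrix.detRowAlternating (R := ℝ)) (fun i => hom (v i)) π
  rw [Units.smul_def, zsmul_eq_mul] at this
  exact this

theorem homDet_snoc_comp_perm (u : Fin k → Space k) (x : Space k) (π : Equiv.Perm (Fin k)) :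
    homDet (Fin.snoc (u ∘ π) x) = (Equiv.Perm.sign π : ℤ) * homDet (Fin.snoc u x) := by
  have := AlternatingMap.map_perm
    ((Matrix.detRowAlternating (R := ℝ) (n := Fin (k + 1))).curryLeft (hom x))
    (fun i => hom (u i)) π
  rw [Units.smul_def, zsmul_eq_mul] at this
  rw [homDet_snoc, homDet_snoc, homDet_cons, homDet_cons, mul_left_comm]
  exact congrArg _ this

/-- Cramer's rule in homogeneous coordinates. -/
theorem sum_homDet_update_smul_hom (v : Fin (k + 1) → Space k) (x : Space k) :
    ∑ i, homDet (Function.update v i x) • hom (v i) = homDet v • hom x := by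
  have h := Matrix.mulVec_cramer (Matrix.of fun i => hom (v i)).transpose (hom x)
  rw [Matrix.det_transpose, Matrix.mulVec_eq_sum] at h
  refine Eq.trans (Finset.sum_congr rfl fun i _ => ?_) h
  rw [Matrix.cramer_transpose_apply]
  have : (fun j => hom (Function.update v i x j)) =
      (Matrix.of fun i => hom (v i)).updateRow i (hom x) := by
    funext j
    by_cases hj : j = i
    · subst hj; simp
    · rw [Function.update_of_ne hj, Matrix.updateRow_ne hj]
      rfl
  rw [homDet, this, op_smul_eq_smul]
  rfl

theorem sum_homDet_update (v : Fin (k + 1) → Space k) (x : Space k) :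
    ∑ i, homDet (Function.update v i x) = homDet v := by
  simpa [hom] using congrFun (sum_homDet_update_smul_hom v x) 0

theorem sum_homDet_update_smul (v : Fin (k + 1) → Space k) (x : Space k) :
    ∑ i, homDet (Function.update v i x) • v i = homDet v • x := by
  ext j
  simpa [hom] using congrFun (sum_homDet_update_smul_hom v x) j.succ

theorem sum_homDet_update_smul_point (v : Fin (k + 1) → Space k) (x : Space k) :
    ∑ i, homDet (Function.update v i x) • point (v i) = homDet v • point x := by
  simpa [point_eq_homPoint] using congrArg homPoint (sum_homDet_update_smul_hom v x)

/-- The contribution of the ordered facet `u` to the boundary sum with base point `o`. -/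
def facetTerm (o : Space k) (u : Fin k → Space k) : Multivector k :=
  ((∑ i, point (u i)) + point o) * join (carrier u) (point o)

theorem facetTerm_eq_smul (o : Space k) (u : Fin k → Space k) :
    facetTerm o u = homDet (Fin.snoc u o) • ((∑ i, point (u i)) + point o) := by
  rw [facetTerm, join_carrier_point, carrier_eq_algebraMap, ← Algebra.commutes,
    ← Algebra.smul_def]

theorem facetTerm_comp_perm (o : Space k) (u : Fin k → Space k) (π : Equiv.Perm (Fin k)) :
    facetTerm o (u ∘ π) = ((Equiv.Perm.sign π : ℤ) : ℝ) • facetTerm o u := by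
  rw [facetTerm_eq_smul, facetTerm_eq_smul, homDet_snoc_comp_perm, smul_smul]
  congr 2
  exact Equiv.sum_comp π fun i => point (u i)

/-- The boundary sum of a single simplex does not depend on the base point: if `o = ∑ λᵢ vᵢ` in
barycentric coordinates, the facet opposite to `vᵢ` carries the weight `λᵢ`, and the
contributions of `o` cancel. -/
theorem sum_facetTerm_succAbove (o : Space k) (v : Fin (k + 1) → Space k) :
    ∑ i : Fin (k + 1), ((-1 : ℝ) ^ (i : ℕ)) • facetTerm o (v ∘ i.succAbove) =
      ((-1) ^ k * homDet v) • ∑ i, point (v i) := by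
  have h (i : Fin (k + 1)) : ((-1 : ℝ) ^ (i : ℕ)) • facetTerm o (v ∘ i.succAbove) =
      (-1 : ℝ) ^ k • (homDet (Function.update v i o) • ((∑ j, point (v j)) + point o)
        - homDet (Function.update v i o) • point (v i)) := by
    rw [facetTerm_eq_smul, smul_smul, homDet_snoc_succAbove, mul_smul, ← smul_sub]
    congr 2
    rw [Fin.sum_univ_succAbove _ i]
    simp only [Function.comp_apply]
    abel
  rw [Finset.sum_congr rfl fun i _ => h i, ← Finset.smul_sum, Finset.sum_sub_distrib,
    ← Finset.sum_smul, sum_homDet_update, sum_homDet_update_smul_point, smul_add,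
    add_sub_cancel_right, mul_smul]

/-! ### Simplices with a common facet -/

theorem hom_affine_combination {a b : ℝ} (hab : a + b = 1) (x y : Space k) :
    hom (a • x + b • y) = a • hom x + b • hom y := by
  funext i
  refine Fin.cases ?_ (fun j => ?_) i <;> simp [hom, hab]

theorem homDet_snoc_affine_combination (u : Fin k → Space k) {a b : ℝ} (hab : a + b = 1)
    (x y : Space k) :
    homDet (Fin.snoc u (a • x + b • y)) =
      a * homDet (Fin.snoc u x) + b * homDet (Fin.snoc u y) := by
  simp only [homDet_snoc, homDet_cons, hom_affine_combination hab, map_add, map_smul,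
    AlternatingMap.add_apply, AlternatingMap.smul_apply, smul_eq_mul]
  ring

theorem homDet_snoc_self (u : Fin k → Space k) (j : Fin k) : homDet (Fin.snoc u (u j)) = 0 := by
  refine AlternatingMap.map_eq_zero_of_eq _ _ (i := j.castSucc) (j := Fin.last k) ?_
    (Fin.castSucc_lt_last j).ne
  simp

theorem homDet_snoc_eq_zero_of_mem_convexHull (u : Fin k → Space k) {x : Space k}
    (hx : x ∈ convexHull ℝ (Set.range u)) : homDet (Fin.snoc u x) = 0 := by
  have hc : Convex ℝ {y : Space k | homDet (Fin.snoc u y) = 0} := by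
    intro y hy z hz a b _ _ hab
    simp only [Set.mem_ofPred_eq] at hy hz ⊢
    rw [homDet_snoc_affine_combination u hab, hy, hz]
    simp
  refine convexHull_min ?_ hc hx
  rintro _ ⟨j, rfl⟩
  exact homDet_snoc_self u j

/-- Two nondegenerate simplices that meet only in their common facet `u` have their remaining
vertices on opposite sides of it: otherwise a point near the centroid of `u`, moved slightly towards
the vertex of one of them, is interior to both. -/
theorem homDet_snoc_mul_homDet_snoc_neg (hk : 1 ≤ k) (u : Fin k → Space k) {x x' : Space k}
    (hx : homDet (Fin.snoc u x) ≠ 0) (hx' : homDet (Fin.snoc u x') ≠ 0)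
    (h : convexHull ℝ (insert x (Set.range u)) ∩ convexHull ℝ (insert x' (Set.range u)) ⊆
      convexHull ℝ (Set.range u)) :
    homDet (Fin.snoc u x) * homDet (Fin.snoc u x') < 0 := by
  by_contra hneg
  have hpos : 0 < homDet (Fin.snoc u x) * homDet (Fin.snoc u x') :=
    lt_of_le_of_ne (not_lt.mp hneg) (mul_ne_zero hx hx').symm
  have hk0 : (k : ℝ) ≠ 0 := by positivity
  set v : Fin (k + 1) → Space k := Fin.snoc u x with hv
  -- barycentric coordinates of `x'` with respect to the first simplex
  set l : Fin (k + 1) → ℝ := fun i => homDet (Function.update v i x') / homDet v with hl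
  have hlast : 0 < l (Fin.last k) := by
    simp only [hl, hv, Fin.update_snoc_last]
    rwa [div_eq_mul_inv, ← mul_pos_iff_of_pos_right (sq_pos_of_ne_zero hx), mul_assoc, sq,
      inv_mul_cancel_left₀ hx, mul_comm]
  have hl1 : ∑ i, l i = 1 := by
    simp only [hl]
    rw [← Finset.sum_div, sum_homDet_update, div_self hx]
  have hlx : ∑ i, l i • v i = x' := by
    have := sum_homDet_update_smul v x'
    simp only [hl, div_eq_inv_mul, mul_smul]
    rw [← Finset.smul_sum, this, inv_smul_smul₀ hx]
  -- barycentric coordinates of the centroid of the facet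
  set c : Fin (k + 1) → ℝ := Fin.snoc (fun _ => (k : ℝ)⁻¹) 0 with hc
  have hc1 : ∑ i, c i = 1 := by
    simp [hc, Fin.sum_univ_castSucc, hk0]
  have hcx : ∑ i, c i • v i = ∑ j, (k : ℝ)⁻¹ • u j := by
    simp [hc, hv, Fin.sum_univ_castSucc]
  -- near the centroid the coordinates on the facet stay positive
  have hev (i : Fin (k + 1)) :
      ∀ᶠ t in nhdsWithin (0 : ℝ) (Set.Ioi 0), 0 ≤ (1 - t) * c i + t * l i := by
    refine Fin.lastCases ?_ (fun j => ?_) i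
    · filter_upwards [self_mem_nhdsWithin] with t ht
      have : 0 ≤ t * l (Fin.last k) := mul_nonneg (le_of_lt ht) hlast.le
      simpa [hc] using this
    · have hcont : Filter.Tendsto (fun t : ℝ => (1 - t) * c j.castSucc + t * l j.castSucc)
          (nhds 0) (nhds ((1 - 0) * c j.castSucc + 0 * l j.castSucc)) := by
        apply Continuous.tendsto
        fun_prop
      have hgt : (0 : ℝ) < (1 - 0) * c j.castSucc + 0 * l j.castSucc := by
        simp [hc]; omega
      exact ((hcont.eventually_const_lt hgt).filter_mono nhdsWithin_le_nhds).mono fun t => le_of_lt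
  obtain ⟨t, ht, ht0, ht1⟩ := ((Filter.eventually_all.mpr hev).and
    ((eventually_mem_nhdsWithin (a := (0 : ℝ)) (s := Set.Ioi 0)).and
      (eventually_nhdsWithin_of_eventually_nhds (eventually_lt_nhds one_pos)))).exists
  set q : Space k := ∑ j, (k : ℝ)⁻¹ • u j with hq
  have hqmem : q ∈ convexHull ℝ (Set.range u) :=
    (convex_convexHull ℝ _).sum_mem (fun _ _ => by positivity) (by simp [hk0])
      fun j _ => subset_convexHull ℝ _ (Set.mem_range_self j)
  have hp1 : (1 - t) • q + t • x' ∈ convexHull ℝ (insert x (Set.range u)) := by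
    have : (1 - t) • q + t • x' = ∑ i, ((1 - t) * c i + t * l i) • v i := by
      simp only [add_smul, mul_smul, Finset.sum_add_distrib, ← Finset.smul_sum, hlx, hcx]
    rw [this]
    refine (convex_convexHull ℝ _).sum_mem (fun i _ => ht i) ?_ fun i _ => subset_convexHull ℝ _ ?_
    · rw [Finset.sum_add_distrib, ← Finset.mul_sum, ← Finset.mul_sum, hc1, hl1]
      ring
    · refine Fin.lastCases ?_ (fun j => ?_) i <;> simp [hv]
  have hp2 : (1 - t) • q + t • x' ∈ convexHull ℝ (insert x' (Set.range u)) :=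
    convex_convexHull ℝ _ (convexHull_mono (Set.subset_insert _ _) hqmem)
      (subset_convexHull ℝ _ (Set.mem_insert _ _)) (sub_nonneg.mpr (le_of_lt ht1)) (le_of_lt ht0)
      (by ring)
  have hp := homDet_snoc_eq_zero_of_mem_convexHull u (h ⟨hp1, hp2⟩)
  rw [homDet_snoc_affine_combination u (by ring), homDet_snoc_eq_zero_of_mem_convexHull u hqmem,
    mul_zero, zero_add] at hp
  exact (mul_ne_zero (ne_of_gt ht0) hx') hp

/-- Only two terms can be nonzero: with three indices, each term would be its own negative. -/
theorem sum_eq_zero_of_pairwise_eq_neg {ι E : Type*} [AddCommGroup E] [Module ℝ E]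
    {t : Finset ι} {f : ι → E} (ht : t.Nontrivial)
    (h : ∀ a ∈ t, ∀ b ∈ t, a ≠ b → f a = -f b) : ∑ a ∈ t, f a = 0 := by
  classical
  obtain ⟨a, ha, b, hb, hab⟩ := ht
  rw [← Finset.sum_subset (s₁ := {a, b}), Finset.sum_pair hab, h a ha b hb hab, neg_add_cancel]
  · simp only [Finset.insert_subset_iff, Finset.singleton_subset_iff]
    exact ⟨ha, hb⟩
  · intro c hc hcab
    simp only [Finset.mem_insert, Finset.mem_singleton, not_or] at hcab
    have h1 : f c = f b := neg_injective ((h a ha c hc (Ne.symm hcab.1)).symm.trans (h a ha b hb hab))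
    have h2 : (2 : ℝ) • f c = 0 := by
      rw [two_smul]
      nth_rw 1 [h c hc b hb hcab.2]
      rw [h1, neg_add_cancel]
    exact (smul_eq_zero.mp h2).resolve_left two_ne_zero

/-- Two injective enumerations of the same set differ by a permutation. -/
theorem exists_perm_eq_comp {ι α : Type*} {f g : ι → α} (hf : f.Injective)
    (hg : g.Injective) (h : Set.range f = Set.range g) : ∃ π : Equiv.Perm ι, g = f ∘ π := by
  refine ⟨(Equiv.ofInjective g hg).trans
    ((Equiv.setCongr h.symm).trans (Equiv.ofInjective f hf).symm), ?_⟩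
  funext i
  simp [Equiv.apply_ofInjective_symm]

theorem coe_vertexSet (v : Fin m → Space k) : (vertexSet v : Set (Space k)) = Set.range v := by
  simp [vertexSet]

theorem injective_of_card_vertexSet {v : Fin m → Space k} (h : (vertexSet v).card = m) :
    Function.Injective v := by
  classical
  unfold vertexSet at h
  convert Finset.card_image_iff.mp (h.trans (Finset.card_fin m).symm) using 1
  simp [Set.injOn_univ]

theorem card_vertexSet {v : Fin m → Space k} (h : Function.Injective v) :
    (vertexSet v).card = m := by
  classical
  unfold vertexSet
  rw [Finset.card_image_of_injective _ h, Finset.card_fin]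

theorem range_eq_insert_succAbove (v : Fin (m + 1) → Space k) (i : Fin (m + 1)) :
    Set.range v = insert (v i) (Set.range (v ∘ i.succAbove)) := by
  rw [Set.range_comp, Fin.range_succAbove, ← Set.image_insert_eq, Set.insert_eq,
    Set.union_compl_self, Set.image_univ]

theorem vertexSet_comp_perm (v : Fin m → Space k) (π : Equiv.Perm (Fin m)) :
    vertexSet (v ∘ π) = vertexSet v := by
  apply Finset.coe_injective
  rw [coe_vertexSet, coe_vertexSet, EquivLike.range_comp]

/-! ### Cancellation of interior facets -/

theorem units_cast_mul_self (s : ℤˣ) : ((s : ℤ) : ℝ) * ((s : ℤ) : ℝ) = 1 := by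
  rcases Int.units_eq_one_or s with rfl | rfl <;> simp

namespace OrientedComplex

variable {K : OrientedComplex k}

theorem vertexSet_mem_faces {v : Fin (k + 1) → Space k} (hv : v ∈ K.simplices) :
    vertexSet v ∈ K.complex.faces :=
  (K.bijOn_simplices.mapsTo hv).1

theorem injective_of_mem_simplices {v : Fin (k + 1) → Space k} (hv : v ∈ K.simplices) :
    Function.Injective v :=
  injective_of_card_vertexSet (K.bijOn_simplices.mapsTo hv).2

theorem IsConsistentlyOriented.exists_homDet_eq {s : ℤˣ} (hs : K.IsConsistentlyOriented s)
    {v : Fin (k + 1) → Space k} (hv : v ∈ K.simplices) :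
    ∃ r : ℝ, 0 < r ∧ homDet v = ((s : ℤ) : ℝ) * r := by
  obtain ⟨r, hr, h⟩ := hs v hv
  refine ⟨r, hr, algebraMap_multivector_injective (k := k) ?_⟩
  rw [← carrier_eq_algebraMap, h]

theorem IsConsistentlyOriented.homDet_eq {s : ℤˣ} (hs : K.IsConsistentlyOriented s)
    {v : Fin (k + 1) → Space k} (hv : v ∈ K.simplices) :
    homDet v = ((s : ℤ) : ℝ) * |homDet v| := by
  obtain ⟨r, hr, h⟩ := hs.exists_homDet_eq hv
  rw [h, abs_mul, abs_of_pos hr]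
  rcases Int.units_eq_one_or s with rfl | rfl <;> simp

theorem IsConsistentlyOriented.homDet_mul_pos {s : ℤˣ} (hs : K.IsConsistentlyOriented s)
    {v v' : Fin (k + 1) → Space k} (hv : v ∈ K.simplices) (hv' : v' ∈ K.simplices) :
    0 < homDet v * homDet v' := by
  obtain ⟨r, hr, h⟩ := hs.exists_homDet_eq hv
  obtain ⟨r', hr', h'⟩ := hs.exists_homDet_eq hv'
  rw [h, h', mul_mul_mul_comm, units_cast_mul_self, one_mul]
  exact mul_pos hr hr'

theorem succAbove_injective_of_mem {v : Fin (k + 1) → Space k} (hv : v ∈ K.simplices)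
    (i : Fin (k + 1)) : Function.Injective (v ∘ i.succAbove) :=
  (injective_of_mem_simplices hv).comp Fin.succAbove_right_injective

theorem vertexSet_succAbove_subset (v : Fin (k + 1) → Space k) (i : Fin (k + 1)) :
    vertexSet (v ∘ i.succAbove) ⊆ vertexSet v := by
  rw [← Finset.coe_subset, coe_vertexSet, coe_vertexSet, range_eq_insert_succAbove v i]
  exact Set.subset_insert _ _

theorem vertexSet_succAbove_mem_faces (hk : 1 ≤ k) {v : Fin (k + 1) → Space k}
    (hv : v ∈ K.simplices) (i : Fin (k + 1)) :
    vertexSet (v ∘ i.succAbove) ∈ K.complex.faces := by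
  refine K.complex.down_closed (vertexSet_mem_faces hv) (vertexSet_succAbove_subset v i) ?_
  rw [← Finset.card_pos, card_vertexSet (succAbove_injective_of_mem hv i)]
  exact hk

theorem eq_of_vertexSet_succAbove_eq {v : Fin (k + 1) → Space k} (hv : v ∈ K.simplices)
    {i j : Fin (k + 1)} (h : vertexSet (v ∘ i.succAbove) = vertexSet (v ∘ j.succAbove)) :
    i = j := by
  by_contra hij
  obtain ⟨l, hl⟩ := Fin.exists_succAbove_eq hij
  have h1 : v i ∈ vertexSet (v ∘ i.succAbove) := by
    rw [h, ← Finset.mem_coe, coe_vertexSet]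
    exact ⟨l, by simp [hl]⟩
  rw [← Finset.mem_coe, coe_vertexSet] at h1
  obtain ⟨l', hl'⟩ := h1
  exact Fin.succAbove_ne i l' (injective_of_mem_simplices hv hl')

theorem exists_vertexSet_succAbove_eq {v : Fin (k + 1) → Space k} (hv : v ∈ K.simplices)
    {F : Finset (Space k)} (hF : F ⊆ vertexSet v) (hcard : F.card = k) :
    ∃ i : Fin (k + 1), vertexSet (v ∘ i.succAbove) = F := by
  obtain ⟨x, hx, hxF⟩ : ∃ x ∈ vertexSet v, x ∉ F := by
    refine Finset.exists_mem_notMem_of_card_lt_card ?_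
    rw [hcard, card_vertexSet (injective_of_mem_simplices hv)]
    exact Nat.lt_succ_self k
  rw [← Finset.mem_coe, coe_vertexSet] at hx
  obtain ⟨i, rfl⟩ := hx
  refine ⟨i, (Finset.eq_of_subset_of_card_le (fun y hy => ?_) ?_).symm⟩
  · have := hF hy
    rw [← Finset.mem_coe, coe_vertexSet, range_eq_insert_succAbove v i] at this
    rcases this with rfl | h
    · exact absurd hy hxF
    · rwa [← Finset.mem_coe, coe_vertexSet]
  · rw [card_vertexSet (succAbove_injective_of_mem hv i), hcard]

/-- Two different `k`-simplices with a common facet induce opposite signs on it, so that the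
contributions of the facet cancel. -/
theorem smul_facetTerm_eq_neg (hk : 1 ≤ k) {s : ℤˣ} (hs : K.IsConsistentlyOriented s)
    (o : Space k) {v v' : Fin (k + 1) → Space k} (hv : v ∈ K.simplices) (hv' : v' ∈ K.simplices)
    (hne : v ≠ v') {i i' : Fin (k + 1)}
    (h : vertexSet (v ∘ i.succAbove) = vertexSet (v' ∘ i'.succAbove)) :
    ((-1 : ℝ) ^ (i : ℕ)) • facetTerm o (v ∘ i.succAbove) =
      -(((-1 : ℝ) ^ (i' : ℕ)) • facetTerm o (v' ∘ i'.succAbove)) := by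
  have hrange := congrArg (fun F : Finset (Space k) => (F : Set (Space k))) h
  simp only [coe_vertexSet] at hrange
  obtain ⟨π, hπ⟩ := exists_perm_eq_comp (succAbove_injective_of_mem hv i)
    (succAbove_injective_of_mem hv' i') hrange
  set u := v ∘ i.succAbove with hu
  have hD := homDet_snoc_succAbove v i (v i)
  have hD' := homDet_snoc_succAbove v' i' (v' i')
  rw [Function.update_eq_self, ← hu] at hD
  rw [Function.update_eq_self, hπ, homDet_snoc_comp_perm] at hD'
  have hpos := hs.homDet_mul_pos hv hv'
  have hneg : homDet (Fin.snoc u (v i)) * homDet (Fin.snoc u (v' i')) < 0 := by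
    refine homDet_snoc_mul_homDet_snoc_neg hk u ?_ ?_ ?_
    · intro h0
      rw [h0, mul_zero] at hD
      rcases mul_eq_zero.mp hD.symm with h1 | h1
      · simp at h1
      · simp [h1] at hpos
    · intro h0
      rw [h0, mul_zero, mul_zero] at hD'
      rcases mul_eq_zero.mp hD'.symm with h1 | h1
      · simp at h1
      · simp [h1] at hpos
    · have hinter := K.complex.inter_subset_convexHull (vertexSet_mem_faces hv)
        (vertexSet_mem_faces hv')
      have hVne : vertexSet v ≠ vertexSet v' := fun h => hne (K.bijOn_simplices.injOn hv hv' h)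
      classical
      have hF : vertexSet v ∩ vertexSet v' = vertexSet u := by
        refine (Finset.eq_of_subset_of_card_le (Finset.subset_inter
          (vertexSet_succAbove_subset v i) (h ▸ vertexSet_succAbove_subset v' i')) ?_).symm
        rw [card_vertexSet (succAbove_injective_of_mem hv i)]
        by_contra hlt
        have hc := card_vertexSet (injective_of_mem_simplices hv)
        have hc' := card_vertexSet (injective_of_mem_simplices hv')
        have e1 := Finset.eq_of_subset_of_card_le
          (Finset.inter_subset_left (s₁ := vertexSet v) (s₂ := vertexSet v')) (by omega)
        have e2 := Finset.eq_of_subset_of_card_le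
          (Finset.inter_subset_right (s₁ := vertexSet v) (s₂ := vertexSet v')) (by omega)
        exact hVne (e1.symm.trans e2)
      rw [← Finset.coe_inter, hF, coe_vertexSet, coe_vertexSet, coe_vertexSet,
        range_eq_insert_succAbove v i, range_eq_insert_succAbove v' i', ← hrange] at hinter
      exact hinter
  rw [hπ, facetTerm_comp_perm, smul_smul, ← neg_smul]
  congr 1
  have hσ := units_cast_mul_self (Equiv.Perm.sign π)
  have hi : ((-1 : ℝ) ^ (i : ℕ)) * (-1) ^ (i : ℕ) = 1 := by rw [← mul_pow]; simp
  have hi' : ((-1 : ℝ) ^ (i' : ℕ)) * (-1) ^ (i' : ℕ) = 1 := by rw [← mul_pow]; simp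
  have hk' : ((-1 : ℝ) ^ k) * (-1) ^ k = 1 := by rw [← mul_pow]; simp
  -- the signs `c` and `c'` that the two simplices induce on `u`
  set c : ℝ := (-1) ^ (i : ℕ)
  set c' : ℝ := (-1) ^ (i' : ℕ) * ((Equiv.Perm.sign π : ℤ) : ℝ) with hc'
  have hcc' : c' * c' = 1 := by
    rw [hc', mul_mul_mul_comm, hi', hσ, one_mul]
  have hprod : c * c' * (homDet (Fin.snoc u (v i)) * homDet (Fin.snoc u (v' i'))) =
      homDet v * homDet v' := by
    rw [← mul_assoc ((-1 : ℝ) ^ (i' : ℕ))] at hD'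
    rw [mul_mul_mul_comm, hD, hD', mul_mul_mul_comm, hk', one_mul]
  have hccneg : c * c' < 0 := by
    by_contra h0
    exact absurd (hprod ▸ hpos) (not_lt.mpr (mul_nonpos_of_nonneg_of_nonpos (not_lt.mp h0) hneg.le))
  have hccm : c * c' = -1 := by
    refine (mul_self_eq_one_iff.mp ?_).resolve_left fun h1 => by linarith
    rw [mul_mul_mul_comm, hi, hcc', one_mul]
  rw [← mul_one c, ← hcc', ← mul_assoc, hccm, neg_one_mul]

/-- The boundary sum is the sum over all facets of all `k`-simplices, as interior facets cancel. -/
theorem sum_boundary_eq_sum_simplices (hk : 1 ≤ k) {s : ℤˣ} (hs : K.IsConsistentlyOriented s)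
    {B : (Fin k → Space k) →₀ ℤ} (hB : K.IsOrientedBoundary B) (o : Space k) :
    (B.sum fun u c => (c : ℝ) • facetTerm o u) =
      ∑ v ∈ K.simplices, ∑ i : Fin (k + 1),
        ((-1 : ℝ) ^ (i : ℕ)) • facetTerm o (v ∘ i.succAbove) := by
  classical
  set P : Finset ((Fin (k + 1) → Space k) × Fin (k + 1)) := K.simplices ×ˢ Finset.univ with hP
  set val : (Fin (k + 1) → Space k) × Fin (k + 1) → Multivector k :=
    fun p => ((-1 : ℝ) ^ (p.2 : ℕ)) • facetTerm o (p.1 ∘ p.2.succAbove) with hval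
  set facet : (Fin (k + 1) → Space k) × Fin (k + 1) → Finset (Space k) :=
    fun p => vertexSet (p.1 ∘ p.2.succAbove) with hfacet
  have hmemP (p) : p ∈ P ↔ p.1 ∈ K.simplices := by simp [hP]
  have hfst {p p'} (hp : p ∈ P) (hf : facet p = facet p') (h1 : p.1 = p'.1) : p = p' := by
    refine Prod.ext h1 ?_
    simp only [hfacet, ← h1] at hf
    exact eq_of_vertexSet_succAbove_eq ((hmemP p).mp hp) hf
  set fiberSum : Finset (Space k) → Multivector k :=
    fun F => ∑ p ∈ P with facet p = F, val p with hfib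
  have hRHS : ∑ v ∈ K.simplices, ∑ i : Fin (k + 1),
        ((-1 : ℝ) ^ (i : ℕ)) • facetTerm o (v ∘ i.succAbove) =
      ∑ F ∈ P.image facet, fiberSum F := by
    rw [← Finset.sum_product', hfib,
      Finset.sum_fiberwise_of_maps_to (fun p hp => Finset.mem_image_of_mem facet hp)]
  -- a boundary facet comes from a single pair (simplex, index)
  have hbdry : ∀ u ∈ B.support, vertexSet u ∈ P.image facet ∧
      (B u : ℝ) • facetTerm o u = fiberSum (vertexSet u) := by
    intro u hu
    obtain ⟨v, hv, i, π, hπ, hBu⟩ := hB.induced u hu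
    have hvi : (v, i) ∈ P := (hmemP _).mpr hv
    have hF : facet (v, i) = vertexSet u := by
      rw [hπ, ← Function.comp_assoc, vertexSet_comp_perm]
    refine ⟨Finset.mem_image.mpr ⟨_, hvi, hF⟩, ?_⟩
    have hsingle : P.filter (fun p => facet p = vertexSet u) = {(v, i)} := by
      ext p
      simp only [Finset.mem_filter, Finset.mem_singleton]
      constructor
      · rintro ⟨hp, hpF⟩
        refine hfst hp (hpF.trans hF.symm) ?_
        have hp1 := (hmemP p).mp hp
        obtain ⟨_, _, G, _, hG⟩ := hB.bijOn_support.mapsTo hu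
        refine K.bijOn_simplices.injOn hp1 hv ((hG _ ?_).trans (hG _ ?_).symm)
        · exact ⟨vertexSet_mem_faces hp1, card_vertexSet (injective_of_mem_simplices hp1),
            hpF ▸ vertexSet_succAbove_subset _ _⟩
        · exact ⟨vertexSet_mem_faces hv, card_vertexSet (injective_of_mem_simplices hv),
            hF ▸ vertexSet_succAbove_subset _ _⟩
      · rintro rfl
        exact ⟨hvi, hF⟩
    rw [hfib]
    simp only [hsingle, Finset.sum_singleton, hval]
    rw [hBu, hπ, ← Function.comp_assoc, facetTerm_comp_perm, smul_smul]
    push_cast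
    rw [mul_assoc, units_cast_mul_self, mul_one]
  have hLHS : (B.sum fun u c => (c : ℝ) • facetTerm o u) =
      ∑ F ∈ B.support.image vertexSet, fiberSum F := by
    rw [Finset.sum_image hB.bijOn_support.injOn]
    exact Finset.sum_congr rfl fun u hu => (hbdry u hu).2
  rw [hLHS, hRHS]
  refine Finset.sum_subset (Finset.image_subset_iff.mpr fun u hu => (hbdry u hu).1) ?_
  -- an interior facet belongs to at least two simplices
  intro F hF hFB
  obtain ⟨p, hp, hpF⟩ := Finset.mem_image.mp hF
  have hp1 := (hmemP p).mp hp
  have hFcard : F.card = k := hpF ▸ card_vertexSet (succAbove_injective_of_mem hp1 p.2)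
  have hFface : F ∈ K.complex.faces := hpF ▸ vertexSet_succAbove_mem_faces hk hp1 p.2
  have hnot : F ∉ K.boundaryFacets := by
    intro hmem
    obtain ⟨u, hu, rfl⟩ := hB.bijOn_support.surjOn hmem
    exact hFB (Finset.mem_image_of_mem _ hu)
  have hex : ∃ G : Finset (Space k), (G ∈ K.complex.faces ∧ G.card = k + 1 ∧ F ⊆ G) ∧
      G ≠ vertexSet p.1 := by
    by_contra! hall
    exact hnot ⟨hFface, hFcard, vertexSet p.1, ⟨vertexSet_mem_faces hp1,
      card_vertexSet (injective_of_mem_simplices hp1), hpF ▸ vertexSet_succAbove_subset _ _⟩, hall⟩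
  obtain ⟨G, ⟨hGface, hGcard, hFG⟩, hGne⟩ := hex
  obtain ⟨v', hv', rfl⟩ := K.bijOn_simplices.surjOn ⟨hGface, hGcard⟩
  obtain ⟨i', hi'⟩ := exists_vertexSet_succAbove_eq hv' hFG hFcard
  refine sum_eq_zero_of_pairwise_eq_neg ?_ ?_
  · refine ⟨p, ?_, (v', i'), ?_, ?_⟩
    · simpa using ⟨hp, hpF⟩
    · simpa using ⟨(hmemP (v', i')).mpr hv', hi'⟩
    · rintro rfl
      exact hGne rfl
  · intro a ha b hb hab
    rw [Finset.mem_filter] at ha hb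
    refine smul_facetTerm_eq_neg hk hs o ((hmemP a).mp ha.1) ((hmemP b).mp hb.1) ?_
      (ha.2.trans hb.2.symm)
    exact fun h => hab (hfst ha.1 (ha.2.trans hb.2.symm) h)

end OrientedComplex

/-! ### Volume and first moment of a simplex -/

/-- Slicing along the first coordinate reduces the volume to `∫ (t - x) ^ n / n!` over `[0, t]`. -/
theorem volume_corner_pi (n : ℕ) {t : ℝ} (ht : 0 ≤ t) :
    volume {y : Fin n → ℝ | (∀ i, 0 ≤ y i) ∧ ∑ i, y i ≤ t} =
      ENNReal.ofReal (t ^ n / n.factorial) := by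
  induction n generalizing t with
  | zero =>
    have : {y : Fin 0 → ℝ | (∀ i, 0 ≤ y i) ∧ ∑ i, y i ≤ t} = Set.univ := by
      ext y; simp [ht]
    rw [this]
    simp [volume_pi]
  | succ n ih =>
    set S : Set (Fin (n + 1) → ℝ) := {y | (∀ i, 0 ≤ y i) ∧ ∑ i, y i ≤ t} with hS
    have hSm : MeasurableSet S := by
      apply IsClosed.measurableSet
      simp only [hS, Set.ofPred_and, Set.ofPred_forall]
      exact (isClosed_iInter fun i => isClosed_le continuous_const (continuous_apply i)).inter
        (isClosed_le (by fun_prop) continuous_const)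
    have hmp := (volume_preserving_piFinSuccAbove (fun _ : Fin (n + 1) => ℝ) 0).symm
    rw [← hmp.measure_preimage hSm.nullMeasurableSet,
      Measure.volume_eq_prod, Measure.prod_apply (hmp.measurable hSm)]
    have hslice (x : ℝ) : volume (Prod.mk x ⁻¹'
        ((MeasurableEquiv.piFinSuccAbove (fun _ : Fin (n + 1) => ℝ) 0).symm ⁻¹' S)) =
        (Set.Icc 0 t).indicator
          (fun x => ENNReal.ofReal ((t - x) ^ n / n.factorial)) x := by
      by_cases hx : x ∈ Set.Icc 0 t
      · rw [Set.indicator_of_mem hx, ← ih (sub_nonneg.mpr hx.2)]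
        congr 1
        ext y
        simp [hS, MeasurableEquiv.piFinSuccAbove, Fin.forall_fin_succ, Fin.sum_univ_succ, hx.1,
          le_sub_iff_add_le']
      · rw [Set.indicator_of_notMem hx]
        convert measure_empty (μ := (volume : Measure (Fin n → ℝ)))
        ext y
        simp only [hS, MeasurableEquiv.piFinSuccAbove, Set.mem_preimage, Set.mem_ofPred_eq,
          Set.mem_empty_iff_false, iff_false]
        simp [Fin.forall_fin_succ, Fin.sum_univ_succ]
        intro h0 hy
        have : 0 ≤ ∑ i, y i := Finset.sum_nonneg fun i _ => hy i
        have : t < x := by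
          by_contra hlt
          exact hx ⟨h0, not_lt.mp hlt⟩
        linarith
    simp_rw [hslice]
    rw [lintegral_indicator measurableSet_Icc, ← ofReal_integral_eq_lintegral_ofReal]
    · congr 1
      rw [integral_Icc_eq_integral_Ioc, ← intervalIntegral.integral_of_le ht,
        intervalIntegral.integral_div,
        intervalIntegral.integral_comp_sub_left (fun x => x ^ n), integral_pow]
      simp only [sub_self, sub_zero, Nat.factorial_succ, Nat.cast_mul, Nat.cast_add, Nat.cast_one]
      rw [zero_pow (Nat.succ_ne_zero n), sub_zero, div_div]
    · exact (by fun_prop : Continuous fun x : ℝ => (t - x) ^ n / n.factorial).integrableOn_Icc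
    · filter_upwards [ae_restrict_mem measurableSet_Icc] with x hx
      have := sub_nonneg.mpr hx.2
      positivity

/-- The corner simplex spanned by the origin and the standard basis vectors. -/
def corner (k : ℕ) : Set (Space k) := {y | (∀ i, 0 ≤ y i) ∧ ∑ i, y i ≤ 1}

theorem isClosed_corner : IsClosed (corner k) := by
  simp only [corner, Set.ofPred_and, Set.ofPred_forall]
  exact (isClosed_iInter fun i => isClosed_le continuous_const (by fun_prop)).inter
    (isClosed_le (by fun_prop) continuous_const)

theorem volume_real_corner : volume.real (corner k) = 1 / k.factorial := by
  rw [Measure.real, ← (PiLp.volume_preserving_toLp (Fin k)).measure_preimage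
    isClosed_corner.measurableSet.nullMeasurableSet]
  have := volume_corner_pi k zero_le_one
  rw [one_pow] at this
  exact (congrArg ENNReal.toReal this).trans (ENNReal.toReal_ofReal (by positivity))

/-- The linear map sending the standard basis vector `j` to `v (j + 1) - v 0`. -/
def edgeMap (v : Fin (k + 1) → Space k) : Space k →ₗ[ℝ] Space k :=
  (EuclideanSpace.basisFun (Fin k) ℝ).toBasis.constr ℝ fun j => v j.succ - v 0

theorem edgeMap_apply (v : Fin (k + 1) → Space k) (y : Space k) :
    edgeMap v y = ∑ j, y j • (v j.succ - v 0) := by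
  simp [edgeMap, Module.Basis.constr_apply_fintype]

/-- Subtracting the first row of the homogeneous coordinates from the others leaves the matrix of the
edge vectors. -/
theorem det_edgeMap (v : Fin (k + 1) → Space k) : LinearMap.det (edgeMap v) = homDet v := by
  set A : Matrix (Fin (k + 1)) (Fin (k + 1)) ℝ := Matrix.of fun i => hom (v i) with hA
  set C : Matrix (Fin (k + 1)) (Fin (k + 1)) ℝ :=
    Matrix.of (Fin.cons (hom (v 0)) fun i => hom (v i.succ) - hom (v 0)) with hC
  have h1 : homDet v = A.det := rfl
  have h2 : A.det = C.det := by
    refine Matrix.det_eq_of_forall_row_eq_smul_add_const (Fin.cons 0 fun _ => 1) 0 (by simp) ?_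
    intro i j
    refine Fin.cases ?_ (fun i => ?_) i <;> simp [hA, hC]
  rw [h1, h2, Matrix.det_succ_column_zero, Fin.sum_univ_succ, Finset.sum_eq_zero]
  · rw [← LinearMap.det_toMatrix (EuclideanSpace.basisFun (Fin k) ℝ).toBasis,
      ← Matrix.det_transpose]
    have : (C 0 0) = 1 := by simp [hC, hom]
    rw [this]
    simp only [Fin.val_zero, pow_zero, one_mul, add_zero]
    congr 1
    ext i j
    simp [LinearMap.toMatrix_apply, edgeMap, hC, hom]
  · intro i _
    simp [hC, hom]

/-- Every ordered simplex is an affine image of the corner simplex. -/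
theorem image_corner (v : Fin (k + 1) → Space k) :
    (fun y => v 0 + edgeMap v y) '' corner k = convexHull ℝ (Set.range v) := by
  apply Set.Subset.antisymm
  · rintro _ ⟨y, ⟨hy, hy1⟩, rfl⟩
    have : v 0 + edgeMap v y =
        ∑ i, (Fin.cons (1 - ∑ j, y j) (fun j => y j) : Fin (k + 1) → ℝ) i • v i := by
      simp only [edgeMap_apply, Fin.sum_univ_succ, Fin.cons_zero, Fin.cons_succ, smul_sub,
        Finset.sum_sub_distrib, sub_smul, one_smul, Finset.sum_smul]
      abel
    simp only [this]
    refine (convex_convexHull ℝ _).sum_mem (fun i _ => ?_) ?_ fun i _ =>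
      subset_convexHull ℝ _ (Set.mem_range_self i)
    · refine Fin.cases ?_ (fun i => ?_) i
      · simpa using hy1
      · simpa using hy i
    · simp [Fin.sum_univ_succ]
  · refine convexHull_min ?_ ?_
    · rintro _ ⟨i, rfl⟩
      refine Fin.cases ⟨0, ?_, by simp⟩ (fun j => ⟨EuclideanSpace.single j 1, ?_, ?_⟩) i
      · simp [corner]
      · constructor
        · intro l
          by_cases h : l = j <;> simp [h]
        · simp
      · simp [edgeMap_apply]
    · have hc : Convex ℝ (corner k) := by
        rintro x ⟨hx, hx1⟩ y ⟨hy, hy1⟩ a b ha hb hab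
        refine ⟨fun i => ?_, ?_⟩
        · have := hx i
          have := hy i
          simp only [PiLp.add_apply, PiLp.smul_apply, smul_eq_mul]
          positivity
        · simp only [PiLp.add_apply, PiLp.smul_apply, smul_eq_mul, Finset.sum_add_distrib,
            ← Finset.mul_sum]
          nlinarith
      have := (hc.linear_image (edgeMap v)).translate (v 0)
      rwa [Set.image_image] at this

/-- The corner is itself the convex hull of finitely many points. -/
theorem isCompact_corner : IsCompact (corner k) := by
  set v : Fin (k + 1) → Space k := Fin.cons 0 fun j => EuclideanSpace.single j 1 with hv
  have h : (fun y => v 0 + edgeMap v y) = id := by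
    funext y
    ext i
    simp [hv, edgeMap_apply, Pi.single_apply]
  have := image_corner v
  rw [h, Set.image_id] at this
  rw [this]
  exact (Set.finite_range v).isCompact_convexHull ℝ

theorem setIntegral_convexHull {E : Type*} [NormedAddCommGroup E] [NormedSpace ℝ E]
    {v : Fin (k + 1) → Space k} (hv : homDet v ≠ 0) (f : Space k → E) :
    ∫ x in convexHull ℝ (Set.range v), f x =
      |homDet v| • ∫ y in corner k, f (v 0 + edgeMap v y) := by
  have hinj : Function.Injective fun y => v 0 + edgeMap v y := by
    refine (add_right_injective (v 0)).comp ?_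
    have : IsUnit (LinearMap.det (edgeMap v)) := by
      rw [det_edgeMap]
      exact hv.isUnit
    exact ((Module.End.isUnit_iff _).mp ((edgeMap v).isUnit_iff_isUnit_det.mpr this)).injective
  rw [← image_corner, integral_image_eq_integral_abs_det_fderiv_smul volume
    (f' := fun _ => LinearMap.toContinuousLinearMap (edgeMap v))
    isClosed_corner.measurableSet ?_ hinj.injOn, integral_smul]
  · congr 2
    rw [← det_edgeMap]
    rfl
  · intro x _
    exact ((LinearMap.toContinuousLinearMap (edgeMap v)).hasFDerivWithinAt).const_add (v 0)

theorem volume_real_convexHull {v : Fin (k + 1) → Space k} (hv : homDet v ≠ 0) :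
    volume.real (convexHull ℝ (Set.range v)) = |homDet v| / k.factorial := by
  have := setIntegral_convexHull hv fun _ => (1 : ℝ)
  simpa [volume_real_corner, div_eq_mul_inv] using this

theorem injective_of_homDet_ne_zero {v : Fin (k + 1) → Space k} (hv : homDet v ≠ 0) :
    Function.Injective v := by
  intro i j hij
  by_contra hne
  exact hv (AlternatingMap.map_eq_zero_of_eq _ _ (congrArg hom hij) hne)

theorem abs_homDet_comp_perm (v : Fin (k + 1) → Space k) (π : Equiv.Perm (Fin (k + 1))) :
    |homDet (v ∘ π)| = |homDet v| := by
  rw [homDet_comp_perm, abs_mul]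
  rcases Int.units_eq_one_or (Equiv.Perm.sign π) with h | h <;> simp [h]

/-- The moments of the corner simplex: the integral of `x` over a simplex is a linear combination of
its vertices with these universal coefficients. -/
def cornerMoment (k : ℕ) : Fin (k + 1) → ℝ :=
  Fin.cons (volume.real (corner k) - ∑ j, ∫ y in corner k, y j) fun j => ∫ y in corner k, y j

theorem setIntegral_convexHull_id_eq_sum {v : Fin (k + 1) → Space k} (hv : homDet v ≠ 0) :
    ∫ x in convexHull ℝ (Set.range v), x = |homDet v| • ∑ i, cornerMoment k i • v i := by
  rw [setIntegral_convexHull hv fun x => x]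
  congr 1
  have hint (j : Fin k) : IntegrableOn (fun y : Space k => y j) (corner k) :=
    Continuous.continuousOn (by fun_prop) |>.integrableOn_compact isCompact_corner
  have hfin : volume (corner k) ≠ ⊤ := isCompact_corner.measure_ne_top
  have hconst : Integrable (fun _ : Space k => v 0) (volume.restrict (corner k)) :=
    integrableOn_const hfin
  simp only [edgeMap_apply]
  rw [integral_add hconst
    (integrable_finsetSum _ fun j _ => (hint j).smul_const _),
    integral_finsetSum _ fun j _ => (hint j).smul_const _]
  simp only [integral_smul_const]
  simp only [setIntegral_const, cornerMoment, Fin.sum_univ_succ, Fin.cons_zero,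
    Fin.cons_succ, smul_sub, Finset.sum_sub_distrib, sub_smul, Finset.sum_smul]
  abel

/-- The first moment of a simplex is its volume times the mean of its vertices. The coefficients of
the vertices agree because exchanging two vertices does not change the simplex. -/
theorem setIntegral_convexHull_id {v : Fin (k + 1) → Space k} (hv : homDet v ≠ 0) :
    ∫ x in convexHull ℝ (Set.range v), x = (|homDet v| / (k + 1).factorial) • ∑ i, v i := by
  have hD : |homDet v| ≠ 0 := abs_ne_zero.mpr hv
  have heq (i j : Fin (k + 1)) : cornerMoment k i = cornerMoment k j := by
    by_cases hij : i = j
    · rw [hij]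
    have hv' : homDet (v ∘ Equiv.swap i j) ≠ 0 := by
      rwa [← abs_ne_zero, abs_homDet_comp_perm, abs_ne_zero]
    have h1 := setIntegral_convexHull_id_eq_sum hv'
    rw [abs_homDet_comp_perm, EquivLike.range_comp, setIntegral_convexHull_id_eq_sum hv] at h1
    have h2 := smul_right_injective _ hD h1
    rw [← sub_eq_zero, ← Finset.sum_sub_distrib, Finset.sum_eq_add i j hij] at h2
    · simp only [Function.comp_apply, Equiv.swap_apply_left, Equiv.swap_apply_right] at h2
      have h3 : (cornerMoment k i - cornerMoment k j) • (v i - v j) = 0 := by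
        rw [← h2]; module
      rcases smul_eq_zero.mp h3 with h | h
      · exact sub_eq_zero.mp h
      · exact absurd (injective_of_homDet_ne_zero hv (sub_eq_zero.mp h)) hij
    · intro l _ hl
      rw [Function.comp_apply, Equiv.swap_apply_of_ne_of_ne hl.1 hl.2, sub_self]
    · simp
    · simp
  have hsum : ∑ i, cornerMoment k i = 1 / k.factorial := by
    simp [cornerMoment, Fin.sum_univ_succ, volume_real_corner]
  have hval (i : Fin (k + 1)) : cornerMoment k i = 1 / (k + 1).factorial := by
    have : ∑ j, cornerMoment k j = ((k : ℝ) + 1) * cornerMoment k i := by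
      rw [Finset.sum_congr rfl fun j _ => heq j i]
      simp
    rw [hsum] at this
    have hk : (k.factorial : ℝ) ≠ 0 := by positivity
    have hk1 : (k : ℝ) + 1 ≠ 0 := by positivity
    rw [Nat.factorial_succ]
    push_cast
    field_simp at this ⊢
    linarith
  rw [setIntegral_convexHull_id_eq_sum hv]
  simp only [hval]
  rw [← Finset.smul_sum, smul_smul, mul_one_div]

/-! ### Integrals over the body of a complex -/

theorem volume_convexHull_eq_zero {F : Finset (Space k)} (hF : F.card ≤ k) :
    volume (convexHull ℝ (F : Set (Space k))) = 0 := by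
  classical
  rcases F.eq_empty_or_nonempty with rfl | hne
  · simp
  refine measure_mono_null (convexHull_subset_affineSpan _)
    (Measure.addHaar_affineSubspace _ _ fun htop => ?_)
  have hpos := Finset.card_pos.mpr hne
  have h1 := finrank_vectorSpan_image_finset_le ℝ (id : Space k → Space k) F
    (n := F.card - 1) (by omega)
  rw [Finset.image_id, ← direction_affineSpan, htop, AffineSubspace.direction_top, finrank_top,
    finrank_euclideanSpace_fin] at h1
  omega

namespace OrientedComplex

variable {K : OrientedComplex k}

theorem isCompact_body : IsCompact K.body :=
  K.finite_faces.isCompact_biUnion fun F _ => F.finite_toSet.isCompact_convexHull ℝ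

theorem convexHull_range_subset_body {v : Fin (k + 1) → Space k} (hv : v ∈ K.simplices) :
    convexHull ℝ (Set.range v) ⊆ K.body := by
  rw [← coe_vertexSet]
  exact K.complex.convexHull_subset_space (vertexSet_mem_faces hv)

/-- Faces of lower dimension are null sets, and there are none of higher dimension. -/
theorem body_ae_eq : K.body =ᵐ[volume] ⋃ v : K.simplices, convexHull ℝ (Set.range v.1) := by
  refine Filter.EventuallyLE.antisymm ?_
    (Set.iUnion_subset fun v => convexHull_range_subset_body v.2).eventuallyLE
  rw [ae_le_set]
  refine measure_mono_null (t := ⋃ F ∈ {F ∈ K.complex.faces | F.card ≤ k},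
    convexHull ℝ (F : Set (Space k))) ?_ ?_
  · rintro x ⟨hx, hxn⟩
    obtain ⟨F, hF, hxF⟩ := K.complex.mem_space_iff.mp hx
    refine Set.mem_biUnion (x := F) ⟨hF, ?_⟩ hxF
    by_contra hcard
    have hle := (K.complex.indep hF).card_le_finrank_succ
    have hle' := Submodule.finrank_le (vectorSpan ℝ (Set.range ((↑) : F → Space k)))
    rw [finrank_euclideanSpace_fin] at hle'
    rw [Fintype.card_coe] at hle
    obtain ⟨v, hv, rfl⟩ := K.bijOn_simplices.surjOn ⟨hF, (by omega : F.card = k + 1)⟩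
    rw [coe_vertexSet] at hxF
    exact hxn (Set.mem_iUnion.mpr ⟨⟨v, hv⟩, hxF⟩)
  · exact (measure_biUnion_null_iff (K.finite_faces.subset fun _ h => h.1).countable).mpr
      fun F hF => volume_convexHull_eq_zero hF.2

theorem aedisjoint_convexHull {v v' : Fin (k + 1) → Space k} (hv : v ∈ K.simplices)
    (hv' : v' ∈ K.simplices) (hne : v ≠ v') :
    AEDisjoint volume (convexHull ℝ (Set.range v)) (convexHull ℝ (Set.range v')) := by
  classical
  have hinter := K.complex.inter_subset_convexHull (vertexSet_mem_faces hv)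
    (vertexSet_mem_faces hv')
  rw [← Finset.coe_inter, coe_vertexSet, coe_vertexSet] at hinter
  refine measure_mono_null hinter (volume_convexHull_eq_zero ?_)
  have hVne : vertexSet v ≠ vertexSet v' := fun h => hne (K.bijOn_simplices.injOn hv hv' h)
  have hc := card_vertexSet (injective_of_mem_simplices hv)
  have hc' := card_vertexSet (injective_of_mem_simplices hv')
  by_contra hlt
  have e1 := Finset.eq_of_subset_of_card_le
    (Finset.inter_subset_left (s₁ := vertexSet v) (s₂ := vertexSet v')) (by omega)
  have e2 := Finset.eq_of_subset_of_card_le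
    (Finset.inter_subset_right (s₁ := vertexSet v) (s₂ := vertexSet v')) (by omega)
  exact hVne (e1.symm.trans e2)

theorem setIntegral_body {E : Type*} [NormedAddCommGroup E] [NormedSpace ℝ E] [CompleteSpace E]
    {f : Space k → E} (hf : IntegrableOn f K.body) :
    ∫ x in K.body, f x = ∑ v ∈ K.simplices, ∫ x in convexHull ℝ (Set.range v), f x := by
  rw [setIntegral_congr_set body_ae_eq, integral_iUnion_ae, tsum_fintype,
    Finset.sum_coe_sort K.simplices fun v => ∫ x in convexHull ℝ (Set.range v), f x]
  · exact fun v =>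
      ((Set.finite_range v.1).isCompact_convexHull ℝ).isClosed.measurableSet.nullMeasurableSet
  · exact fun v v' h => aedisjoint_convexHull v.2 v'.2 fun h' => h (Subtype.ext h')
  · exact hf.mono_set (Set.iUnion_subset fun v => convexHull_range_subset_body v.2)

theorem integrableOn_id_body : IntegrableOn (fun x : Space k => x) K.body :=
  continuous_id.continuousOn.integrableOn_compact isCompact_body

theorem volume_real_body (hD : ∀ v ∈ K.simplices, homDet v ≠ 0) :
    volume.real K.body = ∑ v ∈ K.simplices, |homDet v| / k.factorial := by
  have h := K.setIntegral_body (f := fun _ => (1 : ℝ))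
    (integrableOn_const isCompact_body.measure_ne_top)
  simp only [setIntegral_const, smul_eq_mul, mul_one] at h
  rw [h]
  exact Finset.sum_congr rfl fun v hv => volume_real_convexHull (hD v hv)

theorem setIntegral_body_id (hD : ∀ v ∈ K.simplices, homDet v ≠ 0) :
    ∫ x in K.body, x = ∑ v ∈ K.simplices, (|homDet v| / (k + 1).factorial) • ∑ i, v i := by
  rw [setIntegral_body integrableOn_id_body]
  exact Finset.sum_congr rfl fun v hv => setIntegral_convexHull_id (hD v hv)

/-- The first moment of the body in homogeneous coordinates, whose zeroth component is the
volume. -/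
theorem volume_smul_hom (hD : ∀ v ∈ K.simplices, homDet v ≠ 0) (hvol : volume.real K.body ≠ 0) :
    volume.real K.body • hom ((1 / volume.real K.body) • ∫ x in K.body, x) =
      ∑ v ∈ K.simplices, (|homDet v| / (k + 1).factorial) • ∑ i, hom (v i) := by
  funext j
  refine Fin.cases ?_ (fun j => ?_) j
  · simp only [Finset.sum_apply, Pi.smul_apply, hom, Fin.cons_zero, smul_eq_mul, mul_one,
      Finset.sum_const, Finset.card_univ, Fintype.card_fin, nsmul_eq_mul]
    rw [volume_real_body hD]
    refine Finset.sum_congr rfl fun v _ => ?_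
    rw [Nat.factorial_succ]
    push_cast
    field_simp
  · rw [setIntegral_body_id hD]
    simp [hom, hvol]

end OrientedComplex

theorem centerOfMass_const (C : Set (Space k)) {ρ : ℝ} (hρ : ρ ≠ 0) :
    centerOfMass C (fun _ => ρ) = (1 / volume.real C) • ∫ x in C, x := by
  rw [centerOfMass, setIntegral_const, integral_smul, smul_smul, smul_eq_mul, mul_inv, mul_assoc,
    inv_mul_cancel₀ hρ, mul_one, one_div]

end PGA

end

/-! ### The center of mass -/

theorem mainTheorem4 (k : ℕ) (hk : 1 ≤ k)
    (K : PGA.OrientedComplex k) (hne : K.simplices.Nonempty)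
    (s : ℤˣ) (hs : K.IsConsistentlyOriented s)
    (B : (Fin k → PGA.Space k) →₀ ℤ) (hB : K.IsOrientedBoundary B)
    (ρ : ℝ) (hρ : 0 < ρ) (o : PGA.Space k) :
    let vol : ℝ := volume.real K.body
    let com : PGA.Space k := PGA.centerOfMass K.body (fun _ => ρ)
    let ε : ℝ := (-1) ^ k * ((s : ℤ) : ℝ)
    let S : PGA.Multivector k := B.sum fun v c =>
      (c : ℝ) • (((∑ i, PGA.point (v i)) + PGA.point o) *
        PGA.join (PGA.carrier v) (PGA.point o))
    0 < vol ∧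
    IntegrableOn (fun x : PGA.Space k => x) K.body ∧
    com = (1 / vol) • ∫ x in K.body, x ∧
    PGA.point com = (ε / (vol * (k + 1).factorial)) • S ∧
    (1 / ((k + 1).factorial : ℝ)) • S = (ε * vol) • PGA.point com := by
  intro vol com ε S
  have hD : ∀ v ∈ K.simplices, PGA.homDet v ≠ 0 := fun v hv h => by
    simpa [h] using hs.homDet_mul_pos hv hv
  have hvol : 0 < vol := by
    simp only [vol, K.volume_real_body hD]
    refine Finset.sum_pos (fun v hv => ?_) hne
    have := abs_pos.mpr (hD v hv)
    positivity
  have hcom : com = (1 / vol) • ∫ x in K.body, x := PGA.centerOfMass_const _ hρ.ne'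
  have hfact : ((k + 1).factorial : ℝ) ≠ 0 := by positivity
  have hεε : ε * ε = 1 := by
    rw [mul_mul_mul_comm, PGA.units_cast_mul_self, ← mul_pow]
    simp
  have hpoint : vol • PGA.point com = ∑ v ∈ K.simplices,
      (|PGA.homDet v| / (k + 1).factorial) • ∑ i, PGA.point (v i) := by
    have h := congrArg PGA.homPoint (K.volume_smul_hom hD hvol.ne')
    rw [← hcom] at h
    simpa only [map_smul, map_sum, ← PGA.point_eq_homPoint] using h
  have hmain : (1 / ((k + 1).factorial : ℝ)) • S = (ε * vol) • PGA.point com := by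
    have hS : S = ∑ v ∈ K.simplices, ((-1) ^ k * PGA.homDet v) • ∑ i, PGA.point (v i) := by
      refine (K.sum_boundary_eq_sum_simplices hk hs hB o).trans ?_
      exact Finset.sum_congr rfl fun v _ => PGA.sum_facetTerm_succAbove o v
    rw [mul_smul, hpoint, hS, Finset.smul_sum, Finset.smul_sum]
    refine Finset.sum_congr rfl fun v hv => ?_
    rw [smul_smul, smul_smul]
    congr 1
    have h := hs.homDet_eq hv
    simp only [ε]
    linear_combination ((-1) ^ k / ((k + 1).factorial : ℝ)) * h
  refine ⟨hvol, K.integrableOn_id_body, hcom, ?_, hmain⟩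
  have h : (ε / (vol * (k + 1).factorial)) • S =
      (ε / vol) • ((1 / ((k + 1).factorial : ℝ)) • S) := by
    rw [smul_smul]
    congr 1
    field_simp
  have hone : ε / vol * (ε * vol) = 1 := by
    rw [div_mul_eq_mul_div, ← mul_assoc, hεε, one_mul, div_self hvol.ne']
  rw [h, hmain, smul_smul, hone, one_smul]
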